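/- Let $d\ge 3$ and $1\le k\le d$ be integers, and let $\lambda=(\lambda_1,\dots,\lambda_d)\in\mathbb{R}^d$ satisfy $$1\ge\lambda_1\ge\cdots\ge\lambda_k>\lambda_{k+1}=\cdots=\lambda_d=0 .$$ Put $D_\lambda=\operatorname{diag}(\lambda_1,\dots,\lambda_d)$, $s_i=\operatorname{tr}(D_\lambda^i)$ and $\mathcal{G}_{\lambda,d}=\{OD_\lambda O^{*}: O\in\mathcal{O}(d)\}$, where $\mathcal{O}(d)$ is the group of real orthogonal $d\times d$ matrices. Let $\sigma_{\lambda,d}$ be the probability measure on $\mathcal{G}_{\lambda,d}$ induced by the normalized Haar measure on $\mathcal{O}(d)$, that is, its image under $O\mapsto OD_\lambda O^{*}$. Let $\mathscr{H}_d$ be the space of real symmetric $d\times d$ matrices with the inner product $\langle X,Y\rangle=\operatorname{tr}(XY^{*})$. For $X_1,\dots,X_t\in\mathscr{H}_d$ define the cross-moment $$\mu_{\lambda,d}(X_1,\dots,X_t)=\int_{\mathcal{G}_{\lambda,d}}\langle X_1,P\rangle\cdots\langle X_t,P\rangle\,d\sigma_{\lambda,d}(P).$$ Then, for all $X_1,X_2,X_3\in\mathscr{H}_d$,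 $$\mu_{\lambda,d}(X_1)=\frac{1}{q_{1,d}}\,\alpha_{(1)}\operatorname{tr}(X_1),$$ $$\mu_{\lambda,d}(X_1,X_2)=\frac{1}{q_{2,d}}\Big(\alpha_{(1,1)}\operatorname{tr}(X_1)\operatorname{tr}(X_2)+\alpha_{(2)}\operatorname{tr}(X_1X_2)\Big),$$ $$\begin{aligned}\mu_{\lambda,d}(X_1,X_2,X_3)=\frac{1}{q_{3,d}}\Big(&\alpha_{(1,1,1)}\operatorname{tr}(X_1)\operatorname{tr}(X_2)\operatorname{tr}(X_3)\\&+\frac{\alpha_{(2,1)}}{3}\big(\operatorname{tr}(X_1)\operatorname{tr}(X_2X_3)+\operatorname{tr}(X_2)\operatorname{tr}(X_1X_3)+\operatorname{tr}(X_3)\operatorname{tr}(X_1X_2)\big)\\&+\alpha_{(3)}\operatorname{tr}(X_1X_2X_3)\Big),\end{aligned}$$ where $$q_{1,d}=d,\qquad \alpha_{(1)}=s_1,$$ $$q_{2,d}=(d-1)d(d+2),\qquad \alpha_{(1,1)}=(d+1)s_1^2-2s_2,\qquad \alpha_{(2)}=-2s_1^2+2d\,s_2,$$ $$q_{3,d}=(d-2)(d-1)d(d+2)(d+4),$$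 $$\alpha_{(1,1,1)}=(d^2+3d-2)s_1^3-6(d+2)s_1s_2+16s_3,$$ $$\alpha_{(2,1)}=-6(d+2)s_1^3+6(d^2+2d+4)s_1s_2-24d\,s_3,$$ $$\alpha_{(3)}=16s_1^3-24d\,s_1s_2+8d^2s_3 .$$ -/

import Mathlib

open MeasureTheory
open scoped Matrix

noncomputable section

namespace TraceMoments

/-- Real `d × d` matrices. -/
abbrev Mat (d : ℕ) : Type := Matrix (Fin d) (Fin d) ℝ

/-- The Borel σ-algebra on real square matrices. -/
instance matMeasurableSpace (d : ℕ) : MeasurableSpace (Mat d) := borel (Mat d)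

instance matBorelSpace (d : ℕ) : BorelSpace (Mat d) := ⟨rfl⟩

instance matSecondCountable (d : ℕ) : SecondCountableTopology (Mat d) :=
  inferInstanceAs (SecondCountableTopology (Fin d → Fin d → ℝ))

/-- The orthogonal group `O(d)` (the star operation of `ℝ` is the identity, so that this is the
unitary group over `ℝ`), with the topology and the Borel σ-algebra inherited from matrices. -/
abbrev OrthGroup (d : ℕ) : Type := Matrix.unitaryGroup (Fin d) ℝ

theorem mem_orthGroup_iff {d : ℕ} (A : Mat d) :
    A ∈ Matrix.unitaryGroup (Fin d) ℝ ↔ A * Aᵀ = 1 := by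
  rw [Matrix.mem_unitaryGroup_iff, Matrix.star_eq_conjTranspose,
    Matrix.conjTranspose_eq_transpose_of_trivial]

theorem mem_orthGroup_iff_mem_orthogonalGroup {d : ℕ} (A : Mat d) :
    A ∈ Matrix.unitaryGroup (Fin d) ℝ ↔ A ∈ Matrix.orthogonalGroup (Fin d) ℝ := by
  exact (mem_orthGroup_iff A).trans (Matrix.mem_orthogonalGroup_iff (Fin d) ℝ).symm

instance orthGroupCompactSpace (d : ℕ) : CompactSpace (OrthGroup d) := by
  apply isCompact_iff_compactSpace.mp
  have hK : IsCompact {A : Fin d → Fin d → ℝ | ∀ i, A i ∈ {v : Fin d → ℝ |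
      ∀ j, v j ∈ Set.Icc (-1 : ℝ) 1}} :=
    isCompact_pi_infinite fun _ => isCompact_pi_infinite fun _ => isCompact_Icc
  refine IsCompact.of_isClosed_subset (X := Mat d) hK isClosed_unitary ?_
  intro A hA i j
  have h := entry_norm_bound_of_unitary (𝕜 := ℝ) hA i j
  rw [Real.norm_eq_abs] at h
  exact abs_le.mp h

/-- The Haar probability measure on `O(d)`. -/
def haarProb (d : ℕ) : Measure (OrthGroup d) :=
  Measure.haarMeasure (⊤ : TopologicalSpace.PositiveCompacts (OrthGroup d))

instance haarProb_isHaarMeasure (d : ℕ) : (haarProb d).IsHaarMeasure := by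
  unfold haarProb; infer_instance

instance haarProb_isProbabilityMeasure (d : ℕ) : IsProbabilityMeasure (haarProb d) :=
  ⟨Measure.haarMeasure_self⟩

/-- `D_λ = diag(λ₁, …, λ_d)`. -/
def diagMat {d : ℕ} (lam : Fin d → ℝ) : Mat d := Matrix.diagonal lam

/-- The orbit `G_{λ,d} = {O D_λ Oᵀ : O ∈ O(d)}`. -/
def orbitSet {d : ℕ} (lam : Fin d → ℝ) : Set (Mat d) :=
  {P | ∃ O : OrthGroup d, P = (O : Mat d) * diagMat lam * (O : Mat d)ᵀ}

/-- The map `O ↦ O D_λ Oᵀ` from `O(d)` onto `G_{λ,d}`. -/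
def orbitMap {d : ℕ} (lam : Fin d → ℝ) (O : OrthGroup d) : orbitSet lam :=
  ⟨(O : Mat d) * diagMat lam * (O : Mat d)ᵀ, O, rfl⟩

theorem continuous_orbitMap {d : ℕ} (lam : Fin d → ℝ) : Continuous (orbitMap lam) := by
  unfold orbitMap
  fun_prop

theorem orbitMap_surjective {d : ℕ} (lam : Fin d → ℝ) : Function.Surjective (orbitMap lam) := by
  rintro ⟨P, O, rfl⟩
  exact ⟨O, rfl⟩

/-- The probability measure `σ_{λ,d}` on `G_{λ,d}` induced by the Haar measure of `O(d)`, i.e. the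
law of `O D_λ Oᵀ` for a Haar distributed `O`. -/
def sigma {d : ℕ} (lam : Fin d → ℝ) : Measure (orbitSet lam) :=
  (haarProb d).map (orbitMap lam)

instance sigma_isProbabilityMeasure {d : ℕ} (lam : Fin d → ℝ) :
    IsProbabilityMeasure (sigma lam) :=
  Measure.isProbabilityMeasure_map (continuous_orbitMap lam).measurable.aemeasurable

/-- The Hilbert–Schmidt inner product `⟨X, Y⟩ = tr(X Yᵀ)`. -/
def hsInner {d : ℕ} (X Y : Mat d) : ℝ := (X * Yᵀ).trace

/-- The cross-moments
`μ^β_{λ,d}(X₁, …, X_s) = ∫ ⟨X₁, P⟩^{β₁} ⋯ ⟨X_s, P⟩^{β_s} dσ_{λ,d}(P)`. -/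
def crossMomentPow {d s : ℕ} (lam : Fin d → ℝ) (β : Fin s → ℕ) (X : Fin s → Mat d) : ℝ :=
  ∫ P : orbitSet lam, ∏ i, hsInner (X i) (P : Mat d) ^ β i ∂(sigma lam)

/-- The integrand of a cross-moment is integrable, so that the integral above is a genuine one. -/
theorem integrable_crossMomentPow {d s : ℕ} (lam : Fin d → ℝ) (β : Fin s → ℕ)
    (X : Fin s → Mat d) :
    Integrable (fun P : orbitSet lam => ∏ i, hsInner (X i) (P : Mat d) ^ β i) (sigma lam) := by
  have : CompactSpace (orbitSet lam) :=
    (orbitMap_surjective lam).compactSpace (continuous_orbitMap lam)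
  have hc : Continuous (fun P : orbitSet lam => ∏ i, hsInner (X i) (P : Mat d) ^ β i) := by
    unfold hsInner
    fun_prop
  exact hc.integrable_of_hasCompactSupport (HasCompactSupport.of_compactSpace _)

/-- The cross-moments `μ_{λ,d}(X₁, …, X_s)`, all exponents being one. -/
def crossMoment {d s : ℕ} (lam : Fin d → ℝ) (X : Fin s → Mat d) : ℝ :=
  crossMomentPow lam (fun _ => 1) X

/-- `s_i = tr(D_λ^i)`. -/
def powerTrace {d : ℕ} (lam : Fin d → ℝ) (i : ℕ) : ℝ := (diagMat lam ^ i).trace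

end TraceMoments

end

/-! By left invariance of Haar measure, the law of a random orbit point `P` is invariant under
orthogonal conjugation. The cubic form `X ↦ E[tr(XP)³]` on symmetric matrices is therefore
determined by the eigenvalues of `X`. On diagonal `X`, invariance under permutation matrices makes
it a symmetric cubic polynomial, hence a combination of `(tr X)³`, `tr X · tr X²` and `tr X³`
(`exists_orbitMean_trace_cube`). Polarization yields the trilinear formula with three unknown
coefficients (`exists_tripleMoment_eq`).

Those coefficients solve a linear system: three contractions of the trilinear form against `1` and
`E_ij + E_ji` are constant on the orbit, equal to `s₁³`, `4 s₁ s₂` and `8 s₃`. Its solution is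
`tripleMoment_eq`. The first and second moments come from the third by putting `1` in the remaining
slots: `tr P = s₁` on the orbit, and `s₁ ≠ 0` allows division. -/

noncomputable section

namespace TraceMoments

variable {d : ℕ}

/-! ### Means over the orbit and conjugation invariance -/

/-- The expectation of `f (O D_λ Oᵀ)` for a Haar distributed orthogonal matrix `O`. -/
def orbitMean (lam : Fin d → ℝ) (f : Mat d → ℝ) : ℝ :=
  ∫ O : OrthGroup d, f ((O : Mat d) * diagMat lam * (O : Mat d)ᵀ) ∂(haarProb d)

theorem integrable_orbit (lam : Fin d → ℝ) {f : Mat d → ℝ} (hf : Continuous f) :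
    Integrable (fun O : OrthGroup d => f ((O : Mat d) * diagMat lam * (O : Mat d)ᵀ))
      (haarProb d) := by
  have hc : Continuous (fun O : OrthGroup d => f ((O : Mat d) * diagMat lam * (O : Mat d)ᵀ)) := by
    fun_prop
  exact hc.integrable_of_hasCompactSupport (HasCompactSupport.of_compactSpace _)

theorem orbitMean_add (lam : Fin d → ℝ) {f g : Mat d → ℝ} (hf : Continuous f)
    (hg : Continuous g) :
    orbitMean lam (fun P => f P + g P) = orbitMean lam f + orbitMean lam g :=
  integral_add (integrable_orbit lam hf) (integrable_orbit lam hg)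

theorem orbitMean_sub (lam : Fin d → ℝ) {f g : Mat d → ℝ} (hf : Continuous f)
    (hg : Continuous g) :
    orbitMean lam (fun P => f P - g P) = orbitMean lam f - orbitMean lam g :=
  integral_sub (integrable_orbit lam hf) (integrable_orbit lam hg)

theorem orbitMean_const_mul (lam : Fin d → ℝ) (c : ℝ) (f : Mat d → ℝ) :
    orbitMean lam (fun P => c * f P) = c * orbitMean lam f :=
  integral_const_mul c _

theorem orbitMean_sum (lam : Fin d → ℝ) {ι : Type*} (s : Finset ι) {f : ι → Mat d → ℝ}
    (hf : ∀ i, Continuous (f i)) :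
    orbitMean lam (fun P => ∑ i ∈ s, f i P) = ∑ i ∈ s, orbitMean lam (f i) :=
  integral_finsetSum s fun i _ => integrable_orbit lam (hf i)

/-- A mean over the orbit only depends on the values of the function on the orbit. -/
theorem orbitMean_congr (lam : Fin d → ℝ) {f g : Mat d → ℝ}
    (h : ∀ U : OrthGroup d, f ((U : Mat d) * diagMat lam * (U : Mat d)ᵀ) =
      g ((U : Mat d) * diagMat lam * (U : Mat d)ᵀ)) :
    orbitMean lam f = orbitMean lam g :=
  integral_congr_ae (Filter.Eventually.of_forall h)

theorem orbitMean_const (lam : Fin d → ℝ) (c : ℝ) : orbitMean lam (fun _ => c) = c := by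
  simp [orbitMean]

/-- Conjugating the orbit point by `U` replaces `O` by `U * O`, which Haar measure does not see. -/
theorem orbitMean_conj (lam : Fin d → ℝ) (f : Mat d → ℝ) (U : OrthGroup d) :
    orbitMean lam (fun P => f ((U : Mat d) * P * (U : Mat d)ᵀ)) = orbitMean lam f := by
  have h := integral_mul_left_eq_self (μ := haarProb d)
    (fun O : OrthGroup d => f ((O : Mat d) * diagMat lam * (O : Mat d)ᵀ)) U
  rw [orbitMean, orbitMean, ← h]
  simp only [Submonoid.coe_mul, Matrix.transpose_mul, Matrix.mul_assoc]

theorem orthGroup_mul_transpose (O : OrthGroup d) : (O : Mat d) * (O : Mat d)ᵀ = 1 :=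
  (mem_orthGroup_iff _).mp O.2

theorem orthGroup_transpose_mul (O : OrthGroup d) : (O : Mat d)ᵀ * (O : Mat d) = 1 :=
  mul_eq_one_comm.mp (orthGroup_mul_transpose O)

theorem isSymm_orbit (lam : Fin d → ℝ) (O : OrthGroup d) :
    ((O : Mat d) * diagMat lam * (O : Mat d)ᵀ).IsSymm := by
  simp [Matrix.IsSymm, diagMat, Matrix.transpose_mul, Matrix.mul_assoc]

theorem trace_orbit_pow (lam : Fin d → ℝ) (O : OrthGroup d) (n : ℕ) :
    (((O : Mat d) * diagMat lam * (O : Mat d)ᵀ) ^ n).trace = powerTrace lam n := by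
  have h : ((O : Mat d) * diagMat lam * (O : Mat d)ᵀ) ^ n =
      (O : Mat d) * diagMat lam ^ n * (O : Mat d)ᵀ := by
    induction n with
    | zero => simp [orthGroup_mul_transpose]
    | succ n ih =>
      rw [pow_succ, ih, pow_succ]
      simp only [Matrix.mul_assoc]
      rw [← Matrix.mul_assoc (O : Mat d)ᵀ (O : Mat d), orthGroup_transpose_mul, Matrix.one_mul]
  rw [h, Matrix.trace_mul_comm, ← Matrix.mul_assoc, orthGroup_transpose_mul, Matrix.one_mul,
    powerTrace]

/-! ### Permutation symmetry and diagonal test matrices -/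

/-- The permutation matrix of `σ` as an orthogonal matrix. -/
def permOrth (σ : Equiv.Perm (Fin d)) : OrthGroup d :=
  ⟨σ.permMatrix ℝ, by
    rw [mem_orthGroup_iff, Matrix.transpose_permMatrix, ← Matrix.permMatrix_mul]; simp⟩

theorem permOrth_conj_apply (σ : Equiv.Perm (Fin d)) (P : Mat d) (i j : Fin d) :
    ((permOrth σ : Mat d) * P * (permOrth σ : Mat d)ᵀ) i j = P (σ i) (σ j) := by
  simp [permOrth, Matrix.transpose_permMatrix, Equiv.Perm.permMatrix,
    PEquiv.toMatrix_toPEquiv_mul, PEquiv.mul_toMatrix_toPEquiv, Equiv.Perm.inv_def]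

theorem orbitMean_perm (lam : Fin d → ℝ) (f : Mat d → ℝ) (σ : Equiv.Perm (Fin d)) :
    orbitMean lam (fun P => f (P.submatrix σ σ)) = orbitMean lam f := by
  rw [← orbitMean_conj lam f (permOrth σ)]
  congr! with P
  ext i j
  rw [permOrth_conj_apply, Matrix.submatrix_apply]

/-- The mixed third moment of the diagonal entries of `O D_λ Oᵀ`. -/
def diagMoment (lam : Fin d → ℝ) (i j k : Fin d) : ℝ :=
  orbitMean lam (fun P => P i i * P j j * P k k)

theorem diagMoment_perm (lam : Fin d → ℝ) (σ : Equiv.Perm (Fin d)) (i j k : Fin d) :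
    diagMoment lam (σ i) (σ j) (σ k) = diagMoment lam i j k :=
  orbitMean_perm lam (fun P => P i i * P j j * P k k) σ

theorem diagMoment_swap_left (lam : Fin d → ℝ) (i j k : Fin d) :
    diagMoment lam i j k = diagMoment lam j i k := by
  simp only [diagMoment, mul_comm]

theorem diagMoment_swap_right (lam : Fin d → ℝ) (i j k : Fin d) :
    diagMoment lam i j k = diagMoment lam i k j := by
  simp only [diagMoment, mul_right_comm]

/-- The symmetric group is `n`-transitive for every `n`. -/
theorem exists_perm_apply_eq {n : ℕ} {x y : Fin n → Fin d} (hx : Function.Injective x)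
    (hy : Function.Injective y) : ∃ σ : Equiv.Perm (Fin d), ∀ i, σ (x i) = y i := by
  have := Equiv.Perm.isMultiplyPretransitive (Fin d) n
  obtain ⟨σ, hσ⟩ := MulAction.exists_smul_eq (Equiv.Perm (Fin d))
    (⟨x, hx⟩ : Fin n ↪ Fin d) ⟨y, hy⟩
  exact ⟨σ, fun i => DFunLike.congr_fun hσ i⟩

/-- By permutation invariance, a mixed third moment of the diagonal entries only depends on which
of the three indices coincide. -/
theorem exists_diagMoment_eq (hd : 3 ≤ d) (lam : Fin d → ℝ) :
    ∃ a b c : ℝ, ∀ i j k : Fin d, diagMoment lam i j k =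
      a + b / 3 * ((if i = j then 1 else 0) + (if j = k then 1 else 0) + (if i = k then 1 else 0))
        + c * (if i = j then if j = k then 1 else 0 else 0) := by
  let e : Fin 3 → Fin d := Fin.castLE hd
  have he : Function.Injective e := Fin.castLE_injective hd
  set A := diagMoment lam (e 0) (e 0) (e 0) with hA
  set B := diagMoment lam (e 0) (e 0) (e 1) with hB
  set C := diagMoment lam (e 0) (e 1) (e 2) with hC
  have h3 : ∀ i j k, i ≠ j → j ≠ k → i ≠ k → diagMoment lam i j k = C := by
    intro i j k hij hjk hik
    have hinj : Function.Injective ![i, j, k] := by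
      intro a b hab
      fin_cases a <;> fin_cases b <;> simp_all [eq_comm]
    obtain ⟨σ, hσ⟩ := exists_perm_apply_eq he hinj
    have h0 := hσ 0
    have h1 := hσ 1
    have h2 := hσ 2
    simp at h0 h1 h2
    rw [hC, ← h0, ← h1, ← h2, diagMoment_perm lam σ]
  have h2 : ∀ i k, i ≠ k → diagMoment lam i i k = B := by
    intro i k hik
    have hinj : Function.Injective ![i, k] := by
      intro a b hab
      fin_cases a <;> fin_cases b <;> simp_all [eq_comm]
    have hinj' : Function.Injective ![e 0, e 1] := by
      have : e 0 ≠ e 1 := fun h => by simpa using he h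
      intro a b hab
      fin_cases a <;> fin_cases b <;> simp_all [eq_comm]
    obtain ⟨σ, hσ⟩ := exists_perm_apply_eq hinj' hinj
    have h0 := hσ 0
    have h1 := hσ 1
    simp at h0 h1
    rw [hB, ← h0, ← h1, diagMoment_perm lam σ]
  have h1 : ∀ i, diagMoment lam i i i = A := by
    intro i
    rw [hA, ← diagMoment_perm lam (Equiv.swap (e 0) i) (e 0), Equiv.swap_apply_left]
  -- The constants solve `C = a`, `B = a + b/3`, `A = a + b + c`, for no, exactly one, or all index
  -- pairs equal.
  refine ⟨C, 3 * (B - C), A - 3 * B + 2 * C, fun i j k => ?_⟩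
  by_cases hij : i = j
  · subst hij
    by_cases hik : i = k
    · subst hik
      rw [h1]; simp; ring
    · rw [h2 i k hik]; simp [hik]
  · by_cases hjk : j = k
    · subst hjk
      rw [diagMoment_swap_left, diagMoment_swap_right, h2 j i (Ne.symm hij)]; simp [hij]
    · by_cases hik : i = k
      · subst hik
        rw [diagMoment_swap_right, h2 i j hij]; simp [hij, hjk]
      · rw [h3 i j k hij hjk hik]; simp [hij, hjk, hik]

theorem orbitMean_diagonal (lam x : Fin d → ℝ) :
    orbitMean lam (fun P => (Matrix.diagonal x * P).trace ^ 3) =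
      ∑ i, ∑ j, ∑ k, x i * x j * x k * diagMoment lam i j k := by
  have h : ∀ P : Mat d, (Matrix.diagonal x * P).trace ^ 3 =
      ∑ i, ∑ j, ∑ k, x i * x j * x k * (P i i * P j j * P k k) := by
    intro P
    simp only [Matrix.trace, Matrix.diag_apply, Matrix.diagonal_mul]
    rw [pow_succ, pow_two, Finset.sum_mul_sum, Finset.sum_mul]
    refine Finset.sum_congr rfl fun i _ => ?_
    rw [Finset.sum_mul]
    refine Finset.sum_congr rfl fun j _ => ?_
    rw [Finset.mul_sum]
    exact Finset.sum_congr rfl fun k _ => by ring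
  simp only [h]
  rw [orbitMean_sum _ _ (by fun_prop)]
  refine Finset.sum_congr rfl fun i _ => ?_
  rw [orbitMean_sum _ _ (by fun_prop)]
  refine Finset.sum_congr rfl fun j _ => ?_
  rw [orbitMean_sum _ _ (by fun_prop)]
  exact Finset.sum_congr rfl fun k _ => orbitMean_const_mul _ _ _

theorem exists_orbitMean_diagonal (hd : 3 ≤ d) (lam : Fin d → ℝ) :
    ∃ a b c : ℝ, ∀ x : Fin d → ℝ, orbitMean lam (fun P => (Matrix.diagonal x * P).trace ^ 3) =
      a * (Matrix.diagonal x).trace ^ 3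
        + b * ((Matrix.diagonal x).trace * (Matrix.diagonal x ^ 2).trace)
        + c * (Matrix.diagonal x ^ 3).trace := by
  obtain ⟨a, b, c, h⟩ := exists_diagMoment_eq hd lam
  refine ⟨a, b, c, fun x => ?_⟩
  rw [orbitMean_diagonal]
  simp only [h, mul_add, Finset.sum_add_distrib, mul_ite, mul_one, mul_zero,
    Finset.sum_ite_irrel, Finset.sum_const_zero, Finset.sum_ite_eq, Finset.mem_univ, if_true,
    Matrix.diagonal_pow, Matrix.trace_diagonal, Pi.pow_apply]
  have e1 : ∑ i, ∑ j, ∑ k, x i * x j * x k * a = a * (∑ i, x i) ^ 3 := by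
    simp only [← Finset.sum_mul, ← Finset.mul_sum]
    ring
  have e2 : ∑ i, ∑ k, x i * x i * x k * (b / 3) = b / 3 * ((∑ i, x i) * ∑ i, x i ^ 2) := by
    simp only [← Finset.sum_mul, ← Finset.mul_sum, ← pow_two]
    ring
  have e3 : ∑ i, ∑ j, x i * x j * x j * (b / 3) = b / 3 * ((∑ i, x i) * ∑ i, x i ^ 2) := by
    simp only [mul_assoc, ← Finset.mul_sum, ← Finset.sum_mul]
    simp only [← mul_assoc, ← Finset.sum_mul, ← pow_two]
    ring
  have e4 : ∑ i, ∑ j, x i * x j * x i * (b / 3) = b / 3 * ((∑ i, x i) * ∑ i, x i ^ 2) := by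
    rw [← e2]
    exact Finset.sum_congr rfl fun i _ => Finset.sum_congr rfl fun j _ => by ring
  have e5 : ∑ i, x i * x i * x i * c = c * ∑ i, x i ^ 3 := by
    rw [Finset.mul_sum]
    exact Finset.sum_congr rfl fun i _ => by ring
  rw [e1, e2, e3, e4, e5]
  ring

/-! ### From diagonal to symmetric test matrices, and polarization -/

theorem exists_eq_conj_diagonal {X : Mat d} (hX : X.IsSymm) :
    ∃ (U : OrthGroup d) (x : Fin d → ℝ),
      X = (U : Mat d) * Matrix.diagonal x * (U : Mat d)ᵀ := by
  have hH : X.IsHermitian := by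
    rwa [Matrix.IsHermitian, Matrix.conjTranspose_eq_transpose_of_trivial]
  refine ⟨hH.eigenvectorUnitary, hH.eigenvalues, ?_⟩
  have h := hH.spectral_theorem
  rw [Unitary.conjStarAlgAut_apply, Matrix.star_eq_conjTranspose,
    Matrix.conjTranspose_eq_transpose_of_trivial] at h
  exact h

/-- Both sides are invariant under orthogonal conjugation of `X`, so the spectral theorem reduces to
diagonal `X`. -/
theorem exists_orbitMean_trace_cube (hd : 3 ≤ d) (lam : Fin d → ℝ) :
    ∃ a b c : ℝ, ∀ X : Mat d, X.IsSymm → orbitMean lam (fun P => (X * P).trace ^ 3) =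
      a * X.trace ^ 3 + b * (X.trace * (X ^ 2).trace) + c * (X ^ 3).trace := by
  obtain ⟨a, b, c, h⟩ := exists_orbitMean_diagonal hd lam
  refine ⟨a, b, c, fun X hX => ?_⟩
  obtain ⟨U, x, rfl⟩ := exists_eq_conj_diagonal hX
  have hp1 := trace_orbit_pow x U 1
  have hp2 := trace_orbit_pow x U 2
  have hp3 := trace_orbit_pow x U 3
  simp only [powerTrace, diagMat, pow_one] at hp1 hp2 hp3
  rw [hp1, hp2, hp3, ← h, ← orbitMean_conj lam _ U]
  congr! 3 with P
  have e : (U : Mat d) * Matrix.diagonal x * (U : Mat d)ᵀ * ((U : Mat d) * P * (U : Mat d)ᵀ) =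
      (U : Mat d) * (Matrix.diagonal x * P * (U : Mat d)ᵀ) := by
    simp only [Matrix.mul_assoc]
    rw [← Matrix.mul_assoc (U : Mat d)ᵀ (U : Mat d), orthGroup_transpose_mul, Matrix.one_mul]
  rw [e, Matrix.trace_mul_comm, Matrix.mul_assoc, orthGroup_transpose_mul, Matrix.mul_one]

/-- The mixed third moment of linear functionals on the orbit. -/
def tripleMoment (lam : Fin d → ℝ) (X Y Z : Mat d) : ℝ :=
  orbitMean lam (fun P => (X * P).trace * (Y * P).trace * (Z * P).trace)

/-- Transposition reverses the product, and the trace is cyclic. Hence a single cubic trace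
`tr(XYZ)` suffices in the polarized formula. -/
theorem trace_mul_symm_comm {X Y Z : Mat d} (hX : X.IsSymm) (hY : Y.IsSymm) (hZ : Z.IsSymm) :
    (X * Z * Y).trace = (X * Y * Z).trace := by
  rw [← Matrix.trace_transpose, Matrix.transpose_mul, Matrix.transpose_mul, hX, hY, hZ,
    ← Matrix.mul_assoc, Matrix.trace_mul_cycle, Matrix.trace_mul_cycle]

/-- The polarization identity for cubes. -/
theorem six_mul_tripleMoment (lam : Fin d → ℝ) (X Y Z : Mat d) :
    6 * tripleMoment lam X Y Z =
      orbitMean lam (fun P => ((X + Y + Z) * P).trace ^ 3)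
        - orbitMean lam (fun P => ((X + Y) * P).trace ^ 3)
        - orbitMean lam (fun P => ((X + Z) * P).trace ^ 3)
        - orbitMean lam (fun P => ((Y + Z) * P).trace ^ 3)
        + orbitMean lam (fun P => (X * P).trace ^ 3)
        + orbitMean lam (fun P => (Y * P).trace ^ 3)
        + orbitMean lam (fun P => (Z * P).trace ^ 3) := by
  rw [tripleMoment, ← orbitMean_const_mul, ← orbitMean_sub, ← orbitMean_sub, ← orbitMean_sub,
    ← orbitMean_add, ← orbitMean_add, ← orbitMean_add]
  · refine congrArg _ (funext fun P => ?_)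
    simp only [Matrix.add_mul, Matrix.trace_add]
    ring
  all_goals fun_prop

theorem exists_tripleMoment_eq (hd : 3 ≤ d) (lam : Fin d → ℝ) :
    ∃ a b c : ℝ, ∀ X Y Z : Mat d, X.IsSymm → Y.IsSymm → Z.IsSymm →
      tripleMoment lam X Y Z =
        a * (X.trace * Y.trace * Z.trace)
          + b * (X.trace * (Y * Z).trace + Y.trace * (X * Z).trace + Z.trace * (X * Y).trace)
          + c * (X * Y * Z).trace := by
  obtain ⟨a, b, c, h⟩ := exists_orbitMean_trace_cube hd lam
  -- Polarizing `tr X · tr X²` gives the average of three terms, hence `b / 3`.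
  refine ⟨a, b / 3, c, fun X Y Z hX hY hZ => ?_⟩
  have h6 := six_mul_tripleMoment lam X Y Z
  rw [h _ ((hX.add hY).add hZ), h _ (hX.add hY), h _ (hX.add hZ), h _ (hY.add hZ), h _ hX,
    h _ hY, h _ hZ] at h6
  have c2 : ∀ A B : Mat d, ((A + B) ^ 2).trace =
      (A ^ 2).trace + 2 * (A * B).trace + (B ^ 2).trace := by
    intro A B
    simp only [pow_two, Matrix.add_mul, Matrix.mul_add, Matrix.trace_add]
    rw [Matrix.trace_mul_comm B A]
    ring
  have c3 : ∀ A B : Mat d, ((A + B) ^ 3).trace =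
      (A ^ 3).trace + 3 * (A ^ 2 * B).trace + 3 * (A * B ^ 2).trace + (B ^ 3).trace := by
    intro A B
    have h1 : (A * B * A).trace = (A * A * B).trace := Matrix.trace_mul_cycle A B A
    have h2 : (B * A * A).trace = (A * A * B).trace := by rw [Matrix.trace_mul_cycle, h1]
    have h3 : (B * A * B).trace = (A * B * B).trace := by
      rw [Matrix.trace_mul_cycle, Matrix.trace_mul_cycle]
    have h4 : (B * B * A).trace = (A * B * B).trace := Matrix.trace_mul_cycle B B A
    simp only [pow_succ, pow_zero, Matrix.one_mul, Matrix.add_mul, Matrix.mul_add,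
      Matrix.trace_add, ← Matrix.mul_assoc, h1, h2, h3, h4]
    ring
  have c4 : ((X + Y) ^ 2 * Z).trace =
      (X ^ 2 * Z).trace + 2 * (X * Y * Z).trace + (Y ^ 2 * Z).trace := by
    have : (Y * X * Z).trace = (X * Y * Z).trace := by
      rw [Matrix.trace_mul_cycle, Matrix.trace_mul_cycle, trace_mul_symm_comm hX hY hZ]
    simp only [pow_two, Matrix.add_mul, Matrix.mul_add, Matrix.trace_add, this]
    ring
  simp only [c2, c3, c4, Matrix.trace_add, Matrix.add_mul] at h6
  linarith

/-- The factor `tr P` equals `s₁` throughout the orbit and leaves the mean. -/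
theorem tripleMoment_mul_one (lam : Fin d → ℝ) (X Y : Mat d) :
    tripleMoment lam X Y 1 =
      powerTrace lam 1 * orbitMean lam (fun P => (X * P).trace * (Y * P).trace) := by
  rw [tripleMoment, ← orbitMean_const_mul]
  refine orbitMean_congr lam fun U => ?_
  rw [← trace_orbit_pow lam U 1, pow_one, Matrix.one_mul, mul_comm]

theorem tripleMoment_mul_one_one (lam : Fin d → ℝ) (X : Mat d) :
    tripleMoment lam X 1 1 =
      powerTrace lam 1 ^ 2 * orbitMean lam (fun P => (X * P).trace) := by
  rw [tripleMoment_mul_one, pow_two, mul_assoc,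
    ← orbitMean_const_mul lam _ fun P => (X * P).trace]
  refine congrArg _ (orbitMean_congr lam fun U => ?_)
  rw [← trace_orbit_pow lam U 1, pow_one, Matrix.one_mul, mul_comm]

/-! ### Contractions that determine the coefficients -/

/-- The symmetric matrix `E_ij + E_ji`. -/
def symSingle (i j : Fin d) : Mat d := Matrix.single i j 1 + Matrix.single j i 1

theorem isSymm_symSingle (i j : Fin d) : (symSingle i j).IsSymm := by
  simp [symSingle, Matrix.IsSymm, add_comm]

theorem symSingle_comm (i j : Fin d) : symSingle i j = symSingle j i :=
  add_comm _ _

theorem trace_symSingle_mul (i j : Fin d) (A : Mat d) :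
    (symSingle i j * A).trace = A j i + A i j := by
  simp [symSingle, Matrix.add_mul, Matrix.trace_single_mul]

theorem trace_symSingle (i j : Fin d) :
    (symSingle i j).trace = 2 * if i = j then 1 else 0 := by
  rw [← Matrix.mul_one (symSingle i j), trace_symSingle_mul, Matrix.one_apply, Matrix.one_apply]
  simp only [eq_comm (a := j)]
  ring

theorem symSingle_apply (i j a b : Fin d) :
    symSingle i j a b = (if i = a then if j = b then 1 else 0 else 0)
      + if j = a then if i = b then 1 else 0 else 0 := by
  simp [symSingle, Matrix.single_apply, ite_and]

theorem symSingle_mul_apply (i j a b : Fin d) (A : Mat d) :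
    (symSingle i j * A) a b = (if i = a then A j b else 0) + if j = a then A i b else 0 := by
  simp [Matrix.mul_apply, symSingle_apply, add_mul, Finset.sum_add_distrib,
    Finset.sum_ite_irrel]

theorem sum_trace_symSingle_sq :
    ∑ i : Fin d, ∑ j, (symSingle i j * symSingle i j).trace = 2 * (d : ℝ) ^ 2 + 2 * d := by
  simp only [trace_symSingle_mul, symSingle_apply]
  simp [Finset.sum_add_distrib, eq_comm]
  ring

theorem sum_trace_symSingle_mul_cycle :
    ∑ i : Fin d, ∑ j, ∑ k, (symSingle i j).trace * (symSingle j k * symSingle k i).trace =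
      4 * (d : ℝ) ^ 2 + 4 * d := by
  have h : ∀ i j k : Fin d, (symSingle i j).trace * (symSingle j k * symSingle k i).trace =
      if i = j then 2 * (symSingle i k * symSingle i k).trace else 0 := by
    intro i j k
    rw [trace_symSingle, symSingle_comm k i]
    split_ifs with hij
    · rw [hij, mul_one]
    · ring
  simp only [h, Finset.sum_ite_irrel, Finset.sum_const_zero, Finset.sum_ite_eq, Finset.mem_univ,
    if_true, ← Finset.mul_sum, sum_trace_symSingle_sq]
  ring

theorem sum_trace_symSingle_triple :
    ∑ i : Fin d, ∑ j, ∑ k, (symSingle i j * symSingle j k * symSingle k i).trace =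
      (d : ℝ) ^ 3 + 3 * (d : ℝ) ^ 2 + 4 * d := by
  simp only [Matrix.mul_assoc, trace_symSingle_mul, symSingle_mul_apply, symSingle_apply]
  simp [Finset.sum_add_distrib, Finset.sum_ite_irrel]
  ring

theorem sum_tripleMoment_one_symSingle (lam : Fin d → ℝ) :
    ∑ i, ∑ j, tripleMoment lam 1 (symSingle i j) (symSingle i j) =
      4 * (powerTrace lam 1 * powerTrace lam 2) := by
  have h : orbitMean lam (fun P => ∑ i, ∑ j,
      (1 * P).trace * (symSingle i j * P).trace * (symSingle i j * P).trace) =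
      ∑ i, ∑ j, tripleMoment lam 1 (symSingle i j) (symSingle i j) := by
    rw [orbitMean_sum _ _ (by fun_prop)]
    exact Finset.sum_congr rfl fun i _ => orbitMean_sum _ _ (by fun_prop)
  rw [← h, ← orbitMean_const lam (4 * (powerTrace lam 1 * powerTrace lam 2))]
  refine orbitMean_congr lam fun U => ?_
  have hs := isSymm_orbit lam U
  rw [← trace_orbit_pow lam U 1, ← trace_orbit_pow lam U 2]
  generalize (U : Mat d) * diagMat lam * (U : Mat d)ᵀ = P at hs ⊢
  have h2 : (P ^ 2).trace = ∑ i, ∑ j, P i j * P i j := by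
    simp only [pow_two, Matrix.trace, Matrix.diag_apply, Matrix.mul_apply]
    exact Finset.sum_congr rfl fun i _ => Finset.sum_congr rfl fun j _ => by rw [hs.apply i j]
  -- For symmetric `P` each factor `tr((E_ij + E_ji)P)` is `2 P i j`; two such factors give the
  -- constant 4.
  simp only [h2, trace_symSingle_mul, Matrix.one_mul, pow_one, Finset.mul_sum]
  refine Finset.sum_congr rfl fun i _ => Finset.sum_congr rfl fun j _ => ?_
  rw [hs.apply i j]
  ring

theorem sum_tripleMoment_symSingle_cycle (lam : Fin d → ℝ) :
    ∑ i, ∑ j, ∑ k, tripleMoment lam (symSingle i j) (symSingle j k) (symSingle k i) =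
      8 * powerTrace lam 3 := by
  have h : orbitMean lam (fun P => ∑ i, ∑ j, ∑ k,
      (symSingle i j * P).trace * (symSingle j k * P).trace * (symSingle k i * P).trace) =
      ∑ i, ∑ j, ∑ k, tripleMoment lam (symSingle i j) (symSingle j k) (symSingle k i) := by
    rw [orbitMean_sum _ _ (by fun_prop)]
    refine Finset.sum_congr rfl fun i _ => ?_
    rw [orbitMean_sum _ _ (by fun_prop)]
    exact Finset.sum_congr rfl fun j _ => orbitMean_sum _ _ (by fun_prop)
  rw [← h, ← orbitMean_const lam (8 * powerTrace lam 3)]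
  refine orbitMean_congr lam fun U => ?_
  have hs := isSymm_orbit lam U
  rw [← trace_orbit_pow lam U 3]
  generalize (U : Mat d) * diagMat lam * (U : Mat d)ᵀ = P at hs ⊢
  have h3 : (P ^ 3).trace = ∑ i, ∑ j, ∑ k, P i j * P j k * P k i := by
    rw [pow_succ', pow_two]
    simp only [Matrix.trace, Matrix.diag_apply, Matrix.mul_apply, Finset.mul_sum, mul_assoc]
  simp only [h3, trace_symSingle_mul, Finset.mul_sum]
  refine Finset.sum_congr rfl fun i _ => Finset.sum_congr rfl fun j _ =>
    Finset.sum_congr rfl fun k _ => ?_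
  rw [hs.apply i j, hs.apply j k, hs.apply k i]
  ring

theorem tripleMoment_one (lam : Fin d → ℝ) : tripleMoment lam 1 1 1 = powerTrace lam 1 ^ 3 := by
  rw [← orbitMean_const lam (powerTrace lam 1 ^ 3)]
  refine orbitMean_congr lam fun U => ?_
  rw [← trace_orbit_pow lam U 1, Matrix.one_mul, pow_one]
  ring

/-- The third moment of the orbit: the invariance under conjugation fixes it up to three
coefficients, which the contractions above determine. -/
theorem tripleMoment_eq (hd : 3 ≤ d) (lam : Fin d → ℝ) {X Y Z : Mat d} (hX : X.IsSymm)
    (hY : Y.IsSymm) (hZ : Z.IsSymm) {s₁ s₂ s₃ : ℝ} (hs₁ : s₁ = powerTrace lam 1)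
    (hs₂ : s₂ = powerTrace lam 2) (hs₃ : s₃ = powerTrace lam 3) :
    ((d : ℝ) - 2) * ((d : ℝ) - 1) * d * (d + 2) * (d + 4) * tripleMoment lam X Y Z =
      (((d : ℝ) ^ 2 + 3 * d - 2) * s₁ ^ 3 - 6 * ((d : ℝ) + 2) * s₁ * s₂ + 16 * s₃) *
          (X.trace * Y.trace * Z.trace)
        + (-6 * ((d : ℝ) + 2) * s₁ ^ 3 + 6 * ((d : ℝ) ^ 2 + 2 * d + 4) * s₁ * s₂
            - 24 * (d : ℝ) * s₃) / 3 *
          (X.trace * (Y * Z).trace + Y.trace * (X * Z).trace + Z.trace * (X * Y).trace)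
        + (16 * s₁ ^ 3 - 24 * (d : ℝ) * s₁ * s₂ + 8 * (d : ℝ) ^ 2 * s₃) *
          (X * Y * Z).trace := by
  obtain ⟨a, b, c, h⟩ := exists_tripleMoment_eq hd lam
  have hone : (1 : Mat d).IsSymm := Matrix.isSymm_one
  have hS := isSymm_symSingle (d := d)
  have e1 := tripleMoment_one lam
  rw [h _ _ _ hone hone hone] at e1
  simp only [Matrix.mul_one, Matrix.trace_one, Fintype.card_fin] at e1
  have e2 := sum_tripleMoment_one_symSingle lam
  have f2 : ∀ i j : Fin d, tripleMoment lam 1 (symSingle i j) (symSingle i j) =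
      (d * b + c) * (symSingle i j * symSingle i j).trace
        + (if i = j then 4 * d * a + 8 * b else 0) := by
    intro i j
    rw [h _ _ _ hone (hS i j) (hS i j)]
    simp only [Matrix.one_mul, Matrix.trace_one, Fintype.card_fin, trace_symSingle]
    split_ifs <;> ring
  simp only [f2, Finset.sum_add_distrib, ← Finset.mul_sum, sum_trace_symSingle_sq,
    Finset.sum_ite_eq, Finset.mem_univ, if_true, Finset.sum_const, Finset.card_univ,
    Fintype.card_fin, nsmul_eq_mul] at e2
  have e3 := sum_tripleMoment_symSingle_cycle lam
  have g0 := sum_trace_symSingle_mul_cycle (d := d)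
  simp only [← Finset.mul_sum] at g0
  have g1 : ∑ i : Fin d, ∑ j, ∑ k, (symSingle j k).trace * (symSingle i j * symSingle k i).trace =
      4 * (d : ℝ) ^ 2 + 4 * d := by
    rw [← sum_trace_symSingle_mul_cycle, Finset.sum_comm]
    refine Finset.sum_congr rfl fun j _ => ?_
    rw [Finset.sum_comm]
    refine Finset.sum_congr rfl fun k _ => Finset.sum_congr rfl fun i _ => ?_
    rw [Matrix.trace_mul_comm]
  have g2 : ∑ i : Fin d, ∑ j, ∑ k, (symSingle k i).trace * (symSingle i j * symSingle j k).trace =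
      4 * (d : ℝ) ^ 2 + 4 * d := by
    -- Reordering the sums to `k, i, j` turns the summand into the cyclic one already evaluated.
    simp only [fun i : Fin d => Finset.sum_comm (s := Finset.univ) (t := Finset.univ)
      (f := fun j k => (symSingle k i).trace * (symSingle i j * symSingle j k).trace)]
    rw [Finset.sum_comm, sum_trace_symSingle_mul_cycle]
  have g3 : ∑ i : Fin d, ∑ j, ∑ k,
      (symSingle i j).trace * (symSingle j k).trace * (symSingle k i).trace = 8 * (d : ℝ) := by
    simp [trace_symSingle]
    ring
  simp only [h _ _ _ (hS _ _) (hS _ _) (hS _ _), mul_add, Finset.sum_add_distrib,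
    ← Finset.mul_sum, g0, sum_trace_symSingle_triple, g1, g2, g3] at e3
  rw [h _ _ _ hX hY hZ, hs₁, hs₂, hs₃]
  -- The multipliers of `e1`, `e2`, `e3` here and below are the rows of `q₃` times the inverse of
  -- the 3 × 3 system for `a, b, c`.
  have ha : ((d : ℝ) - 2) * ((d : ℝ) - 1) * d * (d + 2) * (d + 4) * a =
      ((d : ℝ) ^ 2 + 3 * d - 2) * powerTrace lam 1 ^ 3
        - 6 * ((d : ℝ) + 2) * powerTrace lam 1 * powerTrace lam 2 + 16 * powerTrace lam 3 := by
    linear_combination ((d : ℝ) ^ 2 + 3 * d - 2) * e1 - 6 * ((d : ℝ) + 2) / 4 * e2 + 2 * e3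
  have hb : ((d : ℝ) - 2) * ((d : ℝ) - 1) * d * (d + 2) * (d + 4) * b =
      (-6 * ((d : ℝ) + 2) * powerTrace lam 1 ^ 3
        + 6 * ((d : ℝ) ^ 2 + 2 * d + 4) * powerTrace lam 1 * powerTrace lam 2
        - 24 * (d : ℝ) * powerTrace lam 3) / 3 := by
    linear_combination (-2 * ((d : ℝ) + 2)) * e1 + ((d : ℝ) ^ 2 + 2 * d + 4) / 2 * e2
      - (d : ℝ) * e3
  have hc : ((d : ℝ) - 2) * ((d : ℝ) - 1) * d * (d + 2) * (d + 4) * c =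
      16 * powerTrace lam 1 ^ 3 - 24 * (d : ℝ) * powerTrace lam 1 * powerTrace lam 2
        + 8 * (d : ℝ) ^ 2 * powerTrace lam 3 := by
    linear_combination 16 * e1 - 6 * (d : ℝ) * e2 + (d : ℝ) ^ 2 * e3
  rw [← ha, ← hb, ← hc]
  ring

/-- Change of variables along `orbitMap`; symmetry of `P` removes the transpose in the inner
product. -/
theorem crossMoment_eq_orbitMean {s : ℕ} (lam : Fin d → ℝ) (X : Fin s → Mat d) :
    crossMoment lam X = orbitMean lam (fun P => ∏ i, (X i * P).trace) := by
  have hc : Continuous (fun P : orbitSet lam => ∏ i, hsInner (X i) (P : Mat d) ^ 1) := by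
    unfold hsInner
    fun_prop
  rw [crossMoment, crossMomentPow, sigma,
    integral_map (continuous_orbitMap lam).measurable.aemeasurable hc.aestronglyMeasurable]
  refine integral_congr_ae (Filter.Eventually.of_forall fun O => ?_)
  simp only [pow_one, hsInner, orbitMap, (isSymm_orbit lam O).eq]

end TraceMoments

end

theorem theorem7p3 (d k : ℕ) (hd : 3 ≤ d) (hk1 : 1 ≤ k) (hkd : k ≤ d)
    (lam : Fin d → ℝ) (hle : ∀ i, lam i ≤ 1) (hanti : Antitone lam)
    (hpos : ∀ i : Fin d, (i : ℕ) < k → 0 < lam i)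
    (hzero : ∀ i : Fin d, k ≤ (i : ℕ) → lam i = 0)
    (s₁ s₂ s₃ q₁ q₂ q₃ α₁ α₁₁ α₂ α₁₁₁ α₂₁ α₃ : ℝ)
    (hs₁ : s₁ = TraceMoments.powerTrace lam 1)
    (hs₂ : s₂ = TraceMoments.powerTrace lam 2)
    (hs₃ : s₃ = TraceMoments.powerTrace lam 3)
    (hq₁ : q₁ = (d : ℝ))
    (hα₁ : α₁ = s₁)
    (hq₂ : q₂ = ((d : ℝ) - 1) * d * (d + 2))
    (hα₁₁ : α₁₁ = ((d : ℝ) + 1) * s₁ ^ 2 - 2 * s₂)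
    (hα₂ : α₂ = -2 * s₁ ^ 2 + 2 * (d : ℝ) * s₂)
    (hq₃ : q₃ = ((d : ℝ) - 2) * ((d : ℝ) - 1) * d * (d + 2) * (d + 4))
    (hα₁₁₁ : α₁₁₁ = ((d : ℝ) ^ 2 + 3 * d - 2) * s₁ ^ 3 - 6 * ((d : ℝ) + 2) * s₁ * s₂ + 16 * s₃)
    (hα₂₁ : α₂₁ = -6 * ((d : ℝ) + 2) * s₁ ^ 3 + 6 * ((d : ℝ) ^ 2 + 2 * d + 4) * s₁ * s₂
      - 24 * (d : ℝ) * s₃)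
    (hα₃ : α₃ = 16 * s₁ ^ 3 - 24 * (d : ℝ) * s₁ * s₂ + 8 * (d : ℝ) ^ 2 * s₃)
    (X₁ X₂ X₃ : Matrix (Fin d) (Fin d) ℝ)
    (hX₁ : X₁.IsSymm) (hX₂ : X₂.IsSymm) (hX₃ : X₃.IsSymm) :
    TraceMoments.crossMoment lam ![X₁] = 1 / q₁ * (α₁ * X₁.trace) ∧
    TraceMoments.crossMoment lam ![X₁, X₂] =
      1 / q₂ * (α₁₁ * (X₁.trace * X₂.trace) + α₂ * (X₁ * X₂).trace) ∧
    TraceMoments.crossMoment lam ![X₁, X₂, X₃] =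
      1 / q₃ * (α₁₁₁ * (X₁.trace * X₂.trace * X₃.trace)
        + α₂₁ / 3 * (X₁.trace * (X₂ * X₃).trace + X₂.trace * (X₁ * X₃).trace
            + X₃.trace * (X₁ * X₂).trace)
        + α₃ * (X₁ * X₂ * X₃).trace) := by
  have hd' : (3 : ℝ) ≤ d := by exact_mod_cast hd
  -- All eigenvalues are nonnegative and, since `1 ≤ k`, the first is positive.
  have hs0 : s₁ ≠ 0 := by
    have h0 : 0 < s₁ := by
      rw [hs₁, TraceMoments.powerTrace, pow_one, TraceMoments.diagMat, Matrix.trace_diagonal]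
      refine Finset.sum_pos' (fun i _ => ?_)
        ⟨⟨0, by omega⟩, Finset.mem_univ _, hpos _ hk1⟩
      rcases lt_or_ge (i : ℕ) k with hi | hi
      · exact (hpos i hi).le
      · exact (hzero i hi).ge
    exact h0.ne'
  have n0 : (d : ℝ) ≠ 0 := by linarith
  have n1 : (d : ℝ) - 1 ≠ 0 := by linarith
  have n2 : (d : ℝ) - 2 ≠ 0 := by linarith
  have n3 : (d : ℝ) + 2 ≠ 0 := by linarith
  have n4 : (d : ℝ) + 4 ≠ 0 := by linarith
  have hone : (1 : Matrix (Fin d) (Fin d) ℝ).IsSymm := Matrix.isSymm_one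
  have e1 := TraceMoments.tripleMoment_eq hd lam hX₁ hone hone hs₁ hs₂ hs₃
  have e2 := TraceMoments.tripleMoment_eq hd lam hX₁ hX₂ hone hs₁ hs₂ hs₃
  have e3 := TraceMoments.tripleMoment_eq hd lam hX₁ hX₂ hX₃ hs₁ hs₂ hs₃
  rw [TraceMoments.tripleMoment_mul_one_one, ← hs₁] at e1
  rw [TraceMoments.tripleMoment_mul_one, ← hs₁] at e2
  simp only [Matrix.mul_one, Matrix.trace_one, Fintype.card_fin] at e1 e2
  simp only [TraceMoments.crossMoment_eq_orbitMean, Fin.prod_univ_succ, Matrix.cons_val_zero,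
    Matrix.cons_val_succ, Finset.univ_eq_empty, Finset.prod_empty, mul_one, ← mul_assoc]
  subst hq₁ hq₂ hq₃ hα₁ hα₁₁ hα₂ hα₁₁₁ hα₂₁ hα₃
  have N : ((d : ℝ) - 2) * ((d : ℝ) - 1) * d * (d + 2) * (d + 4) ≠ 0 :=
    mul_ne_zero (mul_ne_zero (mul_ne_zero (mul_ne_zero n2 n1) n0) n3) n4
  refine ⟨?_, ?_, ?_⟩
  -- Two slots filled with `1` contribute `s₁ ^ 2`, which is cancelled together with `q₃`.
  · refine mul_left_cancel₀ (mul_ne_zero N (pow_ne_zero 2 hs0)) ?_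
    rw [mul_assoc, e1]
    field_simp
    ring
  · refine mul_left_cancel₀ (mul_ne_zero N hs0) ?_
    rw [mul_assoc, e2]
    field_simp
    ring
  · refine mul_left_cancel₀ N ?_
    rw [← mul_assoc, mul_one_div_cancel N, one_mul]
    exact e3.trans (by ring)
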